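/- Let $G$ be a simple 4-chromatic graph with a fixed embedding in the plane (vertices are distinct points, each edge is a simple arc joining its end vertices and containing no other vertex, and two different edges meet only in common end vertices). Let $(v_1, C_1, v_2, C_2, \dots, C_{n-1}, v_n)$, $n \ge 1$, be a 4-chromatic color fixation chain in $G$; that is, $v_1,\dots,v_n$ are vertices of $G$, each $C_i$ is a 3-critical subgraph of $G$ (equivalently, an odd cycle), for every $i<n$ both $v_i$ and $v_{i+1}$ are directly color fixed by $C_i$, and $C_i$ and (if $i+1<n$) $C_{i+1}$ are directly color fixed by $v_{i+1}$. Here, a subgraph $S$ of $G$ is directly color fixed by a subgraph $R$ if every vertex of $S$ is adjacent to every vertex of $R$, the chromatic numbers $j$ of $R$ and $4-j$ of $S$ add up to $4$, and in every coloring of $G$ with the color set $\{1,2,3,4\}$ in which $R$ has exactly the colors of a set $Z$ with $|Z|=j$, $S$ has exactly the colors of $\{1,2,3,4\}\setminus Z$; a vertex is regarded as a one-vertex subgraph. Then no two distinct vertices among $v_1,\dots,v_n$ are adjaceable. Here, two vertices $x,y$ of $G$ are adjaceable if they are not adjacent and there is no cycle $X$ of $G$ such that $x$ and $y$ are on opposite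 sides of $X$, i.e. such that $x$ and $y$ do not lie on the closed curve formed by the edges of $X$ and are in different connected components of the complement of that curve in the plane. -/

import Mathlib

namespace ColorFixation

universe u

variable {V : Type u}

/-- An embedding of a graph in the plane `ℂ`: vertices are distinct points, every edge is a simple
arc joining the points of its end vertices, a curve passes through no vertex other than its end
vertices, and two different curves meet only in end points. The value of `curve` matters only on
edges; it is the point set of the arc, so it does not depend on a direction of the edge. -/
structure PlaneEmbedding (G : SimpleGraph V) where
  point : V → ℂ
  curve : Sym2 V → Set ℂ
  point_injective : Function.Injective point
  curve_isArc : ∀ x y : V, G.Adj x y →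
    ∃ γ : Path (point x) (point y), Function.Injective γ ∧ Set.range γ = curve s(x, y)
  mem_of_point_mem_curve : ∀ e ∈ G.edgeSet, ∀ w : V, point w ∈ curve e → w ∈ e
  curve_inter_subset : ∀ e ∈ G.edgeSet, ∀ f ∈ G.edgeSet, e ≠ f →
    curve e ∩ curve f ⊆ point '' {w | w ∈ e ∧ w ∈ f}

/-- The closed curve that represents a closed walk: the union of the curves of its edges. -/
def PlaneEmbedding.closedCurve {G : SimpleGraph V} (P : PlaneEmbedding G) {a : V}
    (X : G.Walk a a) : Set ℂ :=
  ⋃ e ∈ X.edges, P.curve e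

/-- `x` and `y` are on opposite sides of `X`: neither point is on the closed curve, and they are in
different connected components of its complement. -/
def PlaneEmbedding.OppositeSides {G : SimpleGraph V} (P : PlaneEmbedding G) {a : V}
    (X : G.Walk a a) (x y : V) : Prop :=
  P.point x ∉ P.closedCurve X ∧ P.point y ∉ P.closedCurve X ∧
    connectedComponentIn (P.closedCurve X)ᶜ (P.point x) ≠
      connectedComponentIn (P.closedCurve X)ᶜ (P.point y)

/-- `x` and `y` are adjaceable: they are not adjacent, and no cycle of the graph has them on
opposite sides. -/
def PlaneEmbedding.Adjaceable {G : SimpleGraph V} (P : PlaneEmbedding G) (x y : V) : Prop :=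
  ¬ G.Adj x y ∧ ¬ ∃ (a : V) (X : G.Walk a a), X.IsCycle ∧ P.OppositeSides X x y

/-- A subgraph is `k`-critical if it is `k`-chromatic and every proper subgraph of it has smaller
chromatic number. -/
def IsCritical {G : SimpleGraph V} (k : ℕ) (C : G.Subgraph) : Prop :=
  C.coe.chromaticNumber = (k : ℕ∞) ∧ ∀ D : G.Subgraph, D < C → D.coe.chromaticNumber < (k : ℕ∞)

/-- `S` is color fixed by `R` with respect to the `k`-colorings of `G`: for some `j ≤ k` the
subgraph `R` is `j`-chromatic and `S` is `(k - j)`-chromatic, and in every `k`-coloring in which `R`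
has exactly the colors of a `j`-set `Z`, `S` has exactly the colors outside `Z`. -/
def ColorFixedBy {G : SimpleGraph V} (k : ℕ) (S R : G.Subgraph) : Prop :=
  ∃ j l : ℕ, j + l = k ∧ R.coe.chromaticNumber = (j : ℕ∞) ∧ S.coe.chromaticNumber = (l : ℕ∞) ∧
    ∀ (c : G.Coloring (Fin k)) (Z : Finset (Fin k)), Z.card = j →
      c '' R.verts = (Z : Set (Fin k)) → c '' S.verts = (Z : Set (Fin k))ᶜ

/-- `S` is directly color fixed by `R`: it is color fixed by `R`, and every vertex of `S` is
adjacent to every vertex of `R`. -/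
def DirectlyColorFixedBy {G : SimpleGraph V} (k : ℕ) (S R : G.Subgraph) : Prop :=
  ColorFixedBy k S R ∧ ∀ s ∈ S.verts, ∀ r ∈ R.verts, G.Adj s r

/-- `(v 0, C 0, v 1, C 1, …, C (n - 1), v n)` is a color fixation chain for `k` colors. No node is
required to be different from another. -/
structure IsColorFixationChain (G : SimpleGraph V) (k : ℕ) {n : ℕ} (v : Fin (n + 1) → V)
    (C : Fin n → G.Subgraph) : Prop where
  critical : ∀ i : Fin n, IsCritical (k - 1) (C i)
  vertex_fixed : ∀ i : Fin n, DirectlyColorFixedBy k (G.singletonSubgraph (v i.castSucc)) (C i)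
  vertex_succ_fixed : ∀ i : Fin n, DirectlyColorFixedBy k (G.singletonSubgraph (v i.succ)) (C i)
  cycle_fixed : ∀ i : Fin n, DirectlyColorFixedBy k (C i) (G.singletonSubgraph (v i.succ))
  cycle_succ_fixed : ∀ i j : Fin n, (j : ℕ) = (i : ℕ) + 1 →
    DirectlyColorFixedBy k (C j) (G.singletonSubgraph (v i.succ))

end ColorFixation

open Complex Set SimpleGraph

namespace ColorFixation

/-! Fix a 4-coloring. Consecutive chain vertices share a color (`IsColorFixationChain.color_eq`) and
have a common cycle in their neighborhoods. Hence all chain vertices are pairwise non-adjacent and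
lie off all these cycles, whose vertices have other colors.

Two vertices off a cycle with three common neighbors on it are on opposite sides: otherwise a path
between them off the cycle would complete a plane drawing of K5, which a parity count of turning
numbers excludes (`turn_relation`).

For x ≠ y in the chain, walk to y and let X be the linking cycle of the last step that leaves x. By
induction X separates x from every later vertex (`PlaneEmbedding.exists_oppositeSides`): if p is
separated from x and the next vertex q is not, the cycle linking p and q must lie on X, since a
vertex of it off X would put p and q on the same side. So q and x have three common neighbors on X,
and q is separated after all. -/

/-! ### Continuous logarithms and turning numbers -/

/-- A nowhere vanishing continuous function on a simply connected, locally path-connected space has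
a continuous logarithm. -/
theorem exists_continuous_log {X : Type*} [TopologicalSpace X] [SimplyConnectedSpace X]
    [LocallyPathConnectedSpace X] {f : X → ℂ} (hf : Continuous f) (h0 : ∀ x, f x ≠ 0) :
    ∃ L : X → ℂ, Continuous L ∧ ∀ x, exp (L x) = f x := by
  obtain ⟨x₀⟩ : Nonempty X := inferInstance
  obtain ⟨F, ⟨-, hF⟩, -⟩ := isCoveringMap_exp.existsUnique_continuousMap_lifts
    (⟨fun x ↦ ⟨f x, h0 x⟩, by fun_prop⟩ : C(X, {z : ℂ // z ≠ 0})) x₀ (log (f x₀))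
    (Subtype.ext (exp_log (h0 x₀)))
  exact ⟨F, F.continuous, fun x ↦ congrArg Subtype.val (congrFun hF x)⟩

/-- The increment of a continuous logarithm depends only on the function up to a constant factor. -/
theorem log_increment_eq {X : Type*} [TopologicalSpace X] [PreconnectedSpace X] {L M : X → ℂ}
    (hL : Continuous L) (hM : Continuous M) {ζ : ℂ} (h : ∀ x, exp (L x) = ζ * exp (M x))
    (x y : X) : L y - L x = M y - M x := by
  have key : L y - M y = L x - M x :=
    -- `L - M` lifts the constant `ζ` through the covering `exp`, so it is constant.
    isCoveringMap_exp.const_of_comp (hL.sub hM) (fun a b ↦ Subtype.ext <| by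
      simp only [Pi.sub_apply, exp_sub, h]
      rw [mul_div_cancel_right₀ _ (exp_ne_zero _), mul_div_cancel_right₀ _ (exp_ne_zero _)]) y x
  linear_combination key

section Turn

variable {a b c d z : ℂ}

/-- A continuous logarithm exists along the path, and its increment depends on no choices. The
factor `ζ` lets the same integer serve for `z - γ`. -/
theorem exists_turn (γ : Path a b) (hz : z ∉ range γ) :
    ∃ n : ℤ, ∀ (L : ℝ → ℂ) (ζ : ℂ), Continuous L → (∀ t, exp (L t) = ζ * (γ.extend t - z)) →
      L 1 - L 0 = log (b - z) - log (a - z) + n * (2 * Real.pi * I) := by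
  have h0 : ∀ t, γ.extend t - z ≠ 0 := fun t h ↦ hz <| by
    rw [← γ.extend_range]
    exact ⟨t, sub_eq_zero.1 h⟩
  obtain ⟨M, hM, hMe⟩ := exists_continuous_log (f := fun t ↦ γ.extend t - z)
    (by fun_prop) h0
  have ha : a - z ≠ 0 := by simpa using h0 0
  have hb : b - z ≠ 0 := by simpa using h0 1
  obtain ⟨n, hn⟩ : ∃ n : ℤ, M 1 - M 0 = log (b - z) - log (a - z) + n * (2 * Real.pi * I) := by
    rw [← exp_eq_exp_iff_exists_int, exp_sub, exp_sub, exp_log ha, exp_log hb, hMe, hMe]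
    simp
  refine ⟨n, fun L ζ hL hLe ↦ ?_⟩
  rw [← hn]
  exact log_increment_eq hL hM (fun t ↦ by rw [hLe, hMe]) 0 1

open Classical in
/-- The number of full turns that a path makes around `z`, in excess of the difference of the
principal arguments at its ends. -/
noncomputable def turn (γ : Path a b) (z : ℂ) : ℤ :=
  if h : z ∉ range γ then (exists_turn γ h).choose else 0

theorem log_sub_log_eq_turn (γ : Path a b) (hz : z ∉ range γ) {L : ℝ → ℂ} {ζ : ℂ}
    (hL : Continuous L) (h : ∀ t, exp (L t) = ζ * (γ.extend t - z)) :
    L 1 - L 0 = log (b - z) - log (a - z) + turn γ z * (2 * Real.pi * I) := by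
  rw [turn, dif_pos hz]
  exact (exists_turn γ hz).choose_spec L ζ hL h

theorem exists_log_neg (hz : z ≠ 0) :
    ∃ m : ℤ, log (-z) = log z + (2 * m + 1) * (Real.pi * I) := by
  have : exp (log (-z)) = exp (log z + Real.pi * I) := by
    rw [exp_log (neg_ne_zero.2 hz), exp_add, exp_log hz, exp_pi_mul_I, mul_neg_one]
  obtain ⟨m, hm⟩ := exp_eq_exp_iff_exists_int.1 this
  exact ⟨m, by rw [hm]; ring⟩

open Classical in
/-- The integer `m` with `log (-z) = log z + (2 m + 1) π i`. -/
noncomputable def logFlip (z : ℂ) : ℤ := if h : z ≠ 0 then (exists_log_neg h).choose else 0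

theorem log_neg_eq_logFlip (hz : z ≠ 0) :
    log (-z) = log z + (2 * logFlip z + 1) * (Real.pi * I) := by
  rw [logFlip, dif_pos hz]
  exact (exists_log_neg hz).choose_spec

/-- Negating twice changes the logarithm by nothing, so the two odd multiples of πi cancel. This -1
is the source of the odd parity for K5. -/
theorem logFlip_sub_comm (h : a ≠ b) : logFlip (a - b) + logFlip (b - a) = -1 := by
  have h1 := log_neg_eq_logFlip (sub_ne_zero.2 h)
  have h2 := log_neg_eq_logFlip (sub_ne_zero.2 h.symm)
  rw [neg_sub] at h1 h2
  have h3 : ((logFlip (a - b) + logFlip (b - a) + 1 : ℤ) : ℂ) * (2 * Real.pi * I) = 0 := by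
    push_cast
    linear_combination -h1 - h2
  have h4 := (mul_eq_zero.1 h3).resolve_right two_pi_I_ne_zero
  have h5 := Int.cast_eq_zero.1 h4
  omega

/-- For disjoint paths, the four turns around the ends of the other path are related: the difference
of two points that run through the paths has a continuous logarithm on a square. -/
theorem turn_relation (γ : Path a b) (δ : Path c d) (h : Disjoint (range γ) (range δ)) :
    turn δ a - turn δ b - turn γ c + turn γ d =
      logFlip (c - b) - logFlip (c - a) - logFlip (d - b) + logFlip (d - a) := by
  have hne : ∀ s t, δ.extend t - γ.extend s ≠ 0 := fun s t h0 ↦ by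
    refine disjoint_left.1 h (?_ : γ.extend s ∈ range γ) ?_
    · rw [← γ.extend_range]; exact ⟨s, rfl⟩
    · rw [← δ.extend_range]; exact ⟨t, sub_eq_zero.1 h0⟩
  have haδ : a ∉ range δ := disjoint_left.1 h ⟨0, γ.source⟩
  have hbδ : b ∉ range δ := disjoint_left.1 h ⟨1, γ.target⟩
  have hcγ : c ∉ range γ := disjoint_right.1 h ⟨0, δ.source⟩
  have hdγ : d ∉ range γ := disjoint_right.1 h ⟨1, δ.target⟩
  have hca : c - a ≠ 0 := by simpa using hne 0 0
  have hcb : c - b ≠ 0 := by simpa using hne 1 0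
  have hda : d - a ≠ 0 := by simpa using hne 0 1
  have hdb : d - b ≠ 0 := by simpa using hne 1 1
  obtain ⟨M, hM, hMe⟩ := exists_continuous_log (X := ℝ × ℝ)
    (f := fun p ↦ δ.extend p.2 - γ.extend p.1) (by fun_prop) (fun p ↦ hne p.1 p.2)
  have e1 := log_sub_log_eq_turn δ haδ (L := fun t ↦ M (0, t)) (ζ := 1) (by fun_prop)
    (fun t ↦ by simp [hMe])
  have e2 := log_sub_log_eq_turn δ hbδ (L := fun t ↦ M (1, t)) (ζ := 1) (by fun_prop)
    (fun t ↦ by simp [hMe])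
  -- On these two sides of the square `γ` moves, so the difference has the opposite sign: hence `ζ =
  -- -1`, and the `logFlip` terms.
  have e3 := log_sub_log_eq_turn γ hcγ (L := fun t ↦ M (t, 0)) (ζ := -1) (by fun_prop)
    (fun t ↦ by simp [hMe])
  have e4 := log_sub_log_eq_turn γ hdγ (L := fun t ↦ M (t, 1)) (ζ := -1) (by fun_prop)
    (fun t ↦ by simp [hMe])
  have f1 := log_neg_eq_logFlip hca
  have f2 := log_neg_eq_logFlip hcb
  have f3 := log_neg_eq_logFlip hda
  have f4 := log_neg_eq_logFlip hdb
  rw [neg_sub] at f1 f2 f3 f4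
  have key : ((turn δ a - turn δ b - turn γ c + turn γ d -
      (logFlip (c - b) - logFlip (c - a) - logFlip (d - b) + logFlip (d - a)) : ℤ) : ℂ) *
      (2 * Real.pi * I) = 0 := by
    push_cast
    linear_combination e2 - e1 + e3 - e4 + f2 - f1 - f4 + f3
  have h4 := (mul_eq_zero.1 key).resolve_right two_pi_I_ne_zero
  have h5 := Int.cast_eq_zero.1 h4
  omega

end Turn

/-! ### Non-planarity of K5 -/

/-- The complete graph on `x`, `y`, `p`, `q`, `r` has no drawing in the plane in which
disjoint edges have disjoint images. -/
theorem not_disjoint_drawing_K5 {x y p q r : ℂ} {U Ap Aq Ar Xp Xq Xr Yp Yq Yr : Set ℂ}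
    (hU : JoinedIn U x y) (hAp : JoinedIn Ap q r) (hAq : JoinedIn Aq p r) (hAr : JoinedIn Ar p q)
    (hXp : JoinedIn Xp x p) (hXq : JoinedIn Xq x q) (hXr : JoinedIn Xr x r)
    (hYp : JoinedIn Yp y p) (hYq : JoinedIn Yq y q) (hYr : JoinedIn Yr y r)
    (hUAp : Disjoint U Ap) (hUAq : Disjoint U Aq) (hUAr : Disjoint U Ar)
    (hXAp : Disjoint Xp Ap) (hXAq : Disjoint Xq Aq) (hXAr : Disjoint Xr Ar)
    (hYAp : Disjoint Yp Ap) (hYAq : Disjoint Yq Aq) (hYAr : Disjoint Yr Ar)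
    (hpq : Disjoint Xp Yq) (hpr : Disjoint Xp Yr) (hqp : Disjoint Xq Yp)
    (hqr : Disjoint Xq Yr) (hrp : Disjoint Xr Yp) (hrq : Disjoint Xr Yq) : False := by
  have rel : ∀ {a b c d : ℂ} {S T : Set ℂ} (hS : JoinedIn S a b) (hT : JoinedIn T c d),
      Disjoint S T → _ := fun hS hT h ↦ turn_relation hS.somePath hT.somePath
    (h.mono (range_subset_iff.2 hS.somePath_mem) (range_subset_iff.2 hT.somePath_mem))
  have ne : ∀ {a b c d : ℂ} {S T : Set ℂ} (hS : JoinedIn S a b) (hT : JoinedIn T c d),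
      Disjoint S T → b ≠ d := fun hS hT h e ↦
    disjoint_left.1 h hS.target_mem (e ▸ hT.target_mem)
  -- One identity for each of the ten pairs of vertices.
  have n1 := logFlip_sub_comm (ne hXp hYq hpq)
  have n2 := logFlip_sub_comm (ne hXp hYr hpr)
  have n3 := logFlip_sub_comm (ne hXq hYr hqr)
  have n4 := logFlip_sub_comm (ne hXp.symm hYq.symm hpq)
  have n5 := logFlip_sub_comm (ne hXp.symm hAp.symm hXAp)
  have n6 := logFlip_sub_comm (ne hXp.symm hAp hXAp)
  have n7 := logFlip_sub_comm (ne hXq.symm hAq.symm hXAq)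
  have n8 := logFlip_sub_comm (ne hYp.symm hAp.symm hYAp)
  have n9 := logFlip_sub_comm (ne hYp.symm hAp hYAp)
  have n0 := logFlip_sub_comm (ne hYq.symm hAq.symm hYAq)
  have r1 := rel hU hAp hUAp
  have r2 := rel hU hAq hUAq
  have r3 := rel hU hAr hUAr
  have r4 := rel hXp hAp hXAp
  have r5 := rel hXq hAq hXAq
  have r6 := rel hXr hAr hXAr
  have r7 := rel hYp hAp hYAp
  have r8 := rel hYq hAq hYAq
  have r9 := rel hYr hAr hYAr
  have s1 := rel hXp hYq hpq
  have s2 := rel hXp hYr hpr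
  have s3 := rel hXq hYp hqp
  have s4 := rel hXq hYr hqr
  have s5 := rel hXr hYp hrp
  have s6 := rel hXr hYq hrq
  -- Add the fifteen relations modulo 2. Each turn occurs in two of them and cancels; each pair of
  -- vertices contributes six `logFlip` terms, and bringing them all to one orientation leaves an
  -- odd constant.
  omega

universe u

variable {V : Type u} {G : SimpleGraph V}

/-! ### Walks and cycles as plane sets -/

/-- The points of a walk in the plane: its vertices and the curves of its edges. -/
def PlaneEmbedding.trace (P : PlaneEmbedding G) {a b : V} (W : G.Walk a b) : Set ℂ :=
  (⋃ e ∈ W.edges, P.curve e) ∪ P.point '' {x | x ∈ W.support}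

namespace PlaneEmbedding

variable (P : PlaneEmbedding G)

theorem mem_trace {a b : V} {W : G.Walk a b} {z : ℂ} :
    z ∈ P.trace W ↔ (∃ e ∈ W.edges, z ∈ P.curve e) ∨ ∃ x ∈ W.support, P.point x = z := by
  simp [trace]

theorem joinedIn_curve {x y : V} (h : G.Adj x y) :
    JoinedIn (P.curve s(x, y)) (P.point x) (P.point y) := by
  obtain ⟨γ, -, hγ⟩ := P.curve_isArc x y h
  exact ⟨γ, fun t ↦ hγ ▸ mem_range_self t⟩

theorem point_mem_curve {e : Sym2 V} (he : e ∈ G.edgeSet) {x : V} (hx : x ∈ e) :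
    P.point x ∈ P.curve e := by
  obtain ⟨y, rfl⟩ := hx
  exact (P.joinedIn_curve he).source_mem

theorem joinedIn_trace {a b : V} (W : G.Walk a b) :
    JoinedIn (P.trace W) (P.point a) (P.point b) := by
  induction W with
  | nil => exact JoinedIn.refl (P.mem_trace.2 (Or.inr ⟨_, by simp, rfl⟩))
  | cons h W ih =>
    refine ((P.joinedIn_curve h).mono fun z hz ↦ ?_).trans (ih.mono fun z hz ↦ ?_)
    · exact P.mem_trace.2 (Or.inl ⟨_, by simp, hz⟩)
    · rw [mem_trace] at hz ⊢
      rcases hz with ⟨e, he, hz⟩ | ⟨x, hx, hz⟩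
      · exact Or.inl ⟨e, by simp [he], hz⟩
      · exact Or.inr ⟨x, by simp [hx], hz⟩

theorem disjoint_trace {a b c d : V} {W : G.Walk a b} {W' : G.Walk c d}
    (h : W.support.Disjoint W'.support) : Disjoint (P.trace W) (P.trace W') := by
  rw [Set.disjoint_left]
  intro z hz hz'
  rw [mem_trace] at hz hz'
  rcases hz with ⟨e, he, hz⟩ | ⟨x, hx, rfl⟩ <;> rcases hz' with ⟨f, hf, hz'⟩ | ⟨y, hy, hz'⟩
  · have hef : e ≠ f := by
      rintro rfl
      induction e with | _ x y =>
      exact h (W.fst_mem_support_of_mem_edges he) (W'.fst_mem_support_of_mem_edges hf)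
    obtain ⟨w, ⟨hwe, hwf⟩, -⟩ := P.curve_inter_subset e (W.edges_subset_edgeSet he) f
      (W'.edges_subset_edgeSet hf) hef ⟨hz, hz'⟩
    exact h (W.mem_support_of_mem_edges he hwe) (W'.mem_support_of_mem_edges hf hwf)
  · subst hz'
    exact h (W.mem_support_of_mem_edges he
      (P.mem_of_point_mem_curve e (W.edges_subset_edgeSet he) y hz)) hy
  · exact h hx (W'.mem_support_of_mem_edges hf
      (P.mem_of_point_mem_curve f (W'.edges_subset_edgeSet hf) x hz'))
  · rw [P.point_injective hz'] at hy
    exact h hx hy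

theorem closedCurve_subset_trace {a : V} (X : G.Walk a a) : P.closedCurve X ⊆ P.trace X :=
  subset_union_left

theorem trace_subset_closedCurve {a b c : V} {X : G.Walk a a} (hX : ¬ X.Nil) {W : G.Walk b c}
    (he : W.edges ⊆ X.edges) (hs : W.support ⊆ X.support) : P.trace W ⊆ P.closedCurve X := by
  intro z hz
  rw [closedCurve, mem_iUnion₂]
  rcases P.mem_trace.1 hz with ⟨e, h, hz⟩ | ⟨x, hx, rfl⟩
  · exact ⟨e, he h, hz⟩
  · obtain ⟨e, h, hxe⟩ := (Walk.mem_support_iff_exists_mem_edges_of_not_nil hX).1 (hs hx)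
    exact ⟨e, h, P.point_mem_curve (X.edges_subset_edgeSet h) hxe⟩

theorem point_mem_closedCurve_iff {a x : V} {X : G.Walk a a} (hX : ¬ X.Nil) :
    P.point x ∈ P.closedCurve X ↔ x ∈ X.support := by
  refine ⟨fun h ↦ ?_, fun h ↦ P.trace_subset_closedCurve hX (List.Subset.refl _)
    (List.Subset.refl _) (P.mem_trace.2 (Or.inr ⟨x, h, rfl⟩))⟩
  rw [closedCurve, mem_iUnion₂] at h
  obtain ⟨e, he, h⟩ := h
  exact X.mem_support_of_mem_edges he
    (P.mem_of_point_mem_curve e (X.edges_subset_edgeSet he) x h)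

theorem isClosed_closedCurve {a : V} (X : G.Walk a a) : IsClosed (P.closedCurve X) := by
  refine Set.Finite.isClosed_biUnion (List.finite_toSet X.edges) fun e he ↦ ?_
  have := X.edges_subset_edgeSet he
  induction e with | _ x y =>
  obtain ⟨γ, -, hγ⟩ := P.curve_isArc x y this
  rw [← hγ]
  exact (isCompact_range γ.continuous).isClosed

/-- Adjacent vertices off a cycle are on the same side of it. -/
theorem connectedComponentIn_eq_of_adj {a x y : V} {X : G.Walk a a} (hx : x ∉ X.support)
    (hy : y ∉ X.support) (h : G.Adj x y) :
    connectedComponentIn (P.closedCurve X)ᶜ (P.point x) =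
      connectedComponentIn (P.closedCurve X)ᶜ (P.point y) := by
  have hd : Disjoint (P.trace h.toWalk) (P.trace X) := P.disjoint_trace <| by
    simp [hx, hy]
  obtain ⟨γ, hγ⟩ := (P.joinedIn_trace h.toWalk).mono
    (hd.mono_right (P.closedCurve_subset_trace X)).subset_compl_right
  exact connectedComponentIn_eq ((isPreconnected_range γ.continuous).subset_connectedComponentIn
    ⟨0, γ.source⟩ (range_subset_iff.2 hγ) ⟨1, γ.target⟩)

end PlaneEmbedding

/-- Two vertices of a cycle are joined along the cycle by a walk that avoids a third vertex. -/
theorem _root_.SimpleGraph.Walk.IsCycle.exists_walk_avoiding {r a b c : V} {X : G.Walk r r}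
    (hX : X.IsCycle) (ha : a ∈ X.support) (hb : b ∈ X.support) (hc : c ∈ X.support) (hac : a ≠ c)
    (hbc : b ≠ c) :
    ∃ W : G.Walk a b, W.edges ⊆ X.edges ∧ W.support ⊆ X.support ∧ c ∉ W.support := by
  classical
  -- Started at `c` and without its first edge, the cycle is a path ending at `c`; its initial
  -- segments up to `a` and `b` miss `c`.
  have hY := hX.rotate hc
  have hYs : ∀ {x}, x ∈ (X.rotate c hc).support ↔ x ∈ X.support := by
    simp
  have hYe : ∀ {e}, e ∈ (X.rotate c hc).edges ↔ e ∈ X.edges := fun {e} ↦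
    (X.rotate_edges c hc).mem_iff
  generalize X.rotate c hc = Y at hY hYs hYe
  cases Y with
  | nil => simp at hY
  | cons h q =>
    rw [Walk.cons_isCycle_iff] at hY
    have hq : ∀ {x}, x ∈ X.support → x ≠ c → x ∈ q.support := fun hx hxc ↦ by
      have := hYs.2 hx
      simpa [hxc] using this
    have ha' := hq ha hac
    have hb' := hq hb hbc
    refine ⟨(q.takeUntil a ha').reverse.append (q.takeUntil b hb'), fun e he ↦ ?_,
      fun x hx ↦ ?_, fun hx ↦ ?_⟩
    · rw [Walk.edges_append, List.mem_append, Walk.edges_reverse, List.mem_reverse] at he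
      refine hYe.1 ?_
      rw [Walk.edges_cons]
      exact List.mem_cons_of_mem _ (he.elim (fun h ↦ q.edges_takeUntil_subset_edges ha' h)
        (fun h ↦ q.edges_takeUntil_subset_edges hb' h))
    · rw [Walk.mem_support_append_iff, Walk.support_reverse, List.mem_reverse] at hx
      refine hYs.1 ?_
      rw [Walk.support_cons]
      exact List.mem_cons_of_mem _ (hx.elim (fun h ↦ q.support_takeUntil_subset_support ha' h)
        (fun h ↦ q.support_takeUntil_subset_support hb' h))
    · rw [Walk.mem_support_append_iff, Walk.support_reverse, List.mem_reverse] at hx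
      exact hx.elim (Walk.endpoint_notMem_support_takeUntil hY.1 ha' hac.symm)
        (Walk.endpoint_notMem_support_takeUntil hY.1 hb' hbc.symm)

/-- A cycle has three distinct vertices. -/
theorem _root_.SimpleGraph.Walk.IsCycle.exists_three_vertices {r : V} {X : G.Walk r r}
    (hX : X.IsCycle) : ∃ a ∈ X.support, ∃ b ∈ X.support, ∃ c ∈ X.support,
      a ≠ b ∧ a ≠ c ∧ b ≠ c := by
  have h3 := hX.three_le_length
  refine ⟨X.getVert 0, X.getVert_mem_support 0, X.getVert 1, X.getVert_mem_support 1,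
    X.getVert 2, X.getVert_mem_support 2, fun h ↦ ?_, fun h ↦ ?_, fun h ↦ ?_⟩
  · simpa using hX.getVert_injOn' (by simp) (by simp; omega) h
  · simpa using hX.getVert_injOn' (by simp) (by simp; omega) h
  · simpa using hX.getVert_injOn' (by simp; omega) (by simp; omega) h

/-- Two vertices off a cycle that have three common neighbours on it are on opposite sides. -/
theorem PlaneEmbedding.oppositeSides_of_three_common_neighbors (P : PlaneEmbedding G) {r : V}
    {X : G.Walk r r} (hX : X.IsCycle) {x y a b c : V} (hxy : x ≠ y) (hx : x ∉ X.support)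
    (hy : y ∉ X.support) (ha : a ∈ X.support) (hb : b ∈ X.support) (hc : c ∈ X.support)
    (hab : a ≠ b) (hac : a ≠ c) (hbc : b ≠ c) (hxa : G.Adj x a) (hxb : G.Adj x b)
    (hxc : G.Adj x c) (hya : G.Adj y a) (hyb : G.Adj y b) (hyc : G.Adj y c) :
    P.OppositeSides X x y := by
  have hx' := (P.point_mem_closedCurve_iff hX.not_nil).not.2 hx
  have hy' := (P.point_mem_closedCurve_iff hX.not_nil).not.2 hy
  refine ⟨hx', hy', fun hcomp ↦ ?_⟩
  have hU : JoinedIn (P.closedCurve X)ᶜ (P.point x) (P.point y) := by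
    have hpc : IsPathConnected (connectedComponentIn (P.closedCurve X)ᶜ (P.point x)) :=
      (P.isClosed_closedCurve
        X).isOpen_compl.connectedComponentIn.isConnected_iff_isPathConnected.1
        (isConnected_connectedComponentIn_iff.2 hx')
    exact (hpc.joinedIn _ (mem_connectedComponentIn hx') _
      (hcomp ▸ mem_connectedComponentIn hy')).mono (connectedComponentIn_subset _ _)
  -- The triangle of the K5. These walks may overlap, since triangle edges share an end and need not
  -- be disjoint.
  obtain ⟨A, hAe, hAs, haA⟩ := hX.exists_walk_avoiding hb hc ha hab.symm hac.symm
  obtain ⟨B, hBe, hBs, hbB⟩ := hX.exists_walk_avoiding ha hc hb hab hbc.symm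
  obtain ⟨C, hCe, hCs, hcC⟩ := hX.exists_walk_avoiding ha hb hc hac hbc
  have hUd : ∀ {s t : V} {W : G.Walk s t}, W.edges ⊆ X.edges → W.support ⊆ X.support →
      Disjoint (P.closedCurve X)ᶜ (P.trace W) := fun he hs ↦
    disjoint_compl_left.mono_right (P.trace_subset_closedCurve hX.not_nil he hs)
  have hWd : ∀ {s t z w : V} {W : G.Walk s t} (h : G.Adj z w), W.support ⊆ X.support →
      z ∉ X.support → w ∉ W.support → Disjoint (P.trace h.toWalk) (P.trace W) :=
    fun h hs hz hw ↦ P.disjoint_trace <| by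
      simpa [hw] using fun h' ↦ hz (hs h')
  have hEd : ∀ {s t : V} (h : G.Adj x s) (h' : G.Adj y t), s ∈ X.support → t ∈ X.support → s ≠ t →
      Disjoint (P.trace h.toWalk) (P.trace h'.toWalk) := fun h h' hs ht hst ↦
    P.disjoint_trace <| by
      have h1 := ne_of_mem_of_not_mem hs hy
      have h2 := ne_of_mem_of_not_mem ht hx
      simp [hxy.symm, hst.symm, h1.symm, h2]
  exact not_disjoint_drawing_K5 hU (P.joinedIn_trace A) (P.joinedIn_trace B) (P.joinedIn_trace C)
    (P.joinedIn_trace hxa.toWalk) (P.joinedIn_trace hxb.toWalk) (P.joinedIn_trace hxc.toWalk)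
    (P.joinedIn_trace hya.toWalk) (P.joinedIn_trace hyb.toWalk) (P.joinedIn_trace hyc.toWalk)
    (hUd hAe hAs) (hUd hBe hBs) (hUd hCe hCs)
    (hWd hxa hAs hx haA) (hWd hxb hBs hx hbB) (hWd hxc hCs hx hcC)
    (hWd hya hAs hy haA) (hWd hyb hBs hy hbB) (hWd hyc hCs hy hcC)
    (hEd hxa hyb ha hb hab) (hEd hxa hyc ha hc hac) (hEd hxb hya hb ha hab.symm)
    (hEd hxb hyc hb hc hbc) (hEd hxc hya hc ha hac.symm) (hEd hxc hyb hc hb hbc.symm)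

/-! ### Linked vertices and the chain -/

/-- Some cycle has all its vertices adjacent to both `x` and `y`. -/
def CycleLinked (G : SimpleGraph V) (x y : V) : Prop :=
  ∃ (a : V) (X : G.Walk a a), X.IsCycle ∧ ∀ t ∈ X.support, G.Adj x t ∧ G.Adj y t

theorem CycleLinked.symm {x y : V} (h : CycleLinked G x y) : CycleLinked G y x := by
  obtain ⟨a, X, hX, h⟩ := h
  exact ⟨a, X, hX, fun t ht ↦ (h t ht).symm⟩

/-- A 3-chromatic graph is not a forest; any cycle in it will do. -/
theorem cycleLinked_of_subgraph {C : G.Subgraph} {x y : V}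
    (hC : C.coe.chromaticNumber = (3 : ℕ)) (hx : ∀ t ∈ C.verts, G.Adj x t)
    (hy : ∀ t ∈ C.verts, G.Adj y t) : CycleLinked G x y := by
  have hcyc : ¬ C.coe.IsAcyclic := fun h ↦ by
    have := h.chromaticNumber_le_two
    rw [hC] at this
    exact absurd this (by decide)
  simp only [IsAcyclic, not_forall, not_not] at hcyc
  obtain ⟨a, X, hX⟩ := hcyc
  refine ⟨_, X.map C.hom, hX.map C.hom_injective, fun t ht ↦ ?_⟩
  rw [Walk.support_map, List.mem_map] at ht
  obtain ⟨s, -, rfl⟩ := ht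
  exact ⟨hx _ s.2, hy _ s.2⟩

/-- In a sequence of steps from `x` to `y ≠ x`, consider the last departure from `x`. -/
theorem _root_.Relation.ReflTransGen.last_departure {α : Type*} {R : α → α → Prop} {x y : α}
    (h : Relation.ReflTransGen R x y) : y = x ∨
      ∃ z, z ≠ x ∧ R x z ∧ Relation.ReflTransGen (fun p q ↦ R p q ∧ q ≠ x) z y := by
  induction h with
  | refl => exact Or.inl rfl
  | @tail p q _ hpq ih =>
    by_cases hq : q = x
    · exact Or.inl hq
    · rcases ih with rfl | ⟨z, hz, hxz, h⟩
      · exact Or.inr ⟨q, hq, hpq, .refl⟩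
      · exact Or.inr ⟨z, hz, hxz, h.tail ⟨hpq, hq⟩⟩

theorem PlaneEmbedding.exists_oppositeSides (P : PlaneEmbedding G) {α : Type*} (c : V → α)
    (hadj : ∀ x y, G.Adj x y → c x ≠ c y) {x y : V} (hxy : x ≠ y)
    (h : Relation.ReflTransGen (fun p q ↦ CycleLinked G p q ∧ c p = c q) x y) :
    ∃ (a : V) (X : G.Walk a a), X.IsCycle ∧ P.OppositeSides X x y := by
  obtain rfl | ⟨z, hzx, ⟨⟨a, X, hX, hXn⟩, hcz⟩, hzy⟩ := h.last_departure
  · exact absurd rfl hxy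
  refine ⟨a, X, hX, ?_⟩
  -- Vertices of `X` are adjacent to `x`, so none has its color.
  have off : ∀ {w}, c x = c w → w ∉ X.support := fun hw hwX ↦ hadj _ _ (hXn _ hwX).1 hw
  have opp : ∀ {w u₁ u₂ u₃ : V}, c x = c w → w ≠ x → u₁ ∈ X.support → u₂ ∈ X.support →
      u₃ ∈ X.support → u₁ ≠ u₂ → u₁ ≠ u₃ → u₂ ≠ u₃ → G.Adj w u₁ → G.Adj w u₂ → G.Adj w u₃ →
      P.OppositeSides X x w := fun hw hwx h1 h2 h3 h12 h13 h23 a1 a2 a3 ↦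
    P.oppositeSides_of_three_common_neighbors hX hwx.symm (off rfl) (off hw) h1 h2 h3 h12 h13 h23
      (hXn _ h1).1 (hXn _ h2).1 (hXn _ h3).1 a1 a2 a3
  -- The color is carried through the induction because `off` needs it.
  suffices P.OppositeSides X x y ∧ c x = c y from this.1
  clear hxy h
  induction hzy with
  | refl =>
    obtain ⟨u₁, h1, u₂, h2, u₃, h3, h12, h13, h23⟩ := hX.exists_three_vertices
    exact ⟨opp hcz hzx h1 h2 h3 h12 h13 h23 (hXn _ h1).2 (hXn _ h2).2 (hXn _ h3).2, hcz⟩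
  | @tail p q _ hpq ih =>
    obtain ⟨⟨⟨_, X', hX', hXn'⟩, hcpq⟩, hqx⟩ := hpq
    obtain ⟨⟨hx, hp, hne⟩, hcp⟩ := ih
    have hcq : c x = c q := hcp.trans hcpq
    refine ⟨?_, hcq⟩
    by_contra hnot
    have hqX := (P.point_mem_closedCurve_iff hX.not_nil).not.2 (off hcq)
    have hsame : connectedComponentIn (P.closedCurve X)ᶜ (P.point x) =
        connectedComponentIn (P.closedCurve X)ᶜ (P.point q) :=
      by_contra fun h ↦ hnot ⟨hx, hqX, h⟩
    have hsub : ∀ t ∈ X'.support, t ∈ X.support := fun t ht ↦ by_contra fun htX ↦ hne <|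
      hsame.trans ((P.connectedComponentIn_eq_of_adj (off hcq) htX (hXn' t ht).2).trans
        (P.connectedComponentIn_eq_of_adj (off hcp) htX (hXn' t ht).1).symm)
    obtain ⟨u₁, h1, u₂, h2, u₃, h3, h12, h13, h23⟩ := hX'.exists_three_vertices
    exact hnot (opp hcq hqx (hsub _ h1) (hsub _ h2) (hsub _ h3) h12 h13 h23
      (hXn' _ h1).2 (hXn' _ h2).2 (hXn' _ h3).2)

/-- In a coloring with four colors, consecutive vertices of a color fixation chain have the same
color. -/
theorem IsColorFixationChain.color_eq {n : ℕ} {v : Fin (n + 1) → V} {C : Fin n → G.Subgraph}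
    (h : IsColorFixationChain G 4 v C) (c : G.Coloring (Fin 4)) (i : Fin n) :
    c (v i.castSucc) = c (v i.succ) := by
  have hC : (C i).coe.chromaticNumber = (3 : ℕ) := (h.critical i).1
  obtain ⟨⟨j, l, hjl, -, hl, hfix⟩, -⟩ := h.cycle_fixed i
  obtain ⟨⟨j', l', -, hj', -, hfix'⟩, -⟩ := h.vertex_fixed i
  -- Thus `j = 1`: the color of the vertex forces its complement on the cycle, which forces that
  -- color back on the preceding vertex.
  have hl3 : l = 3 := by exact_mod_cast hl.symm.trans hC
  have hj3 : j' = 3 := by exact_mod_cast hj'.symm.trans hC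
  have h1 := hfix c {c (v i.succ)} (by simp; omega) (by simp)
  have h2 := hfix' c {c (v i.succ)}ᶜ (by simp [Finset.card_compl, hj3]) (by simpa using h1)
  simpa using h2

/-- Steps are reversible, so going through `v 0` avoids comparing `i` and `j`. -/
theorem IsColorFixationChain.reflTransGen {n : ℕ} {v : Fin (n + 1) → V} {C : Fin n → G.Subgraph}
    (h : IsColorFixationChain G 4 v C) (c : G.Coloring (Fin 4)) (i j : Fin (n + 1)) :
    Relation.ReflTransGen (fun p q ↦ CycleLinked G p q ∧ c p = c q) (v i) (v j) := by
  have step : ∀ i : Fin n, CycleLinked G (v i.castSucc) (v i.succ) := fun i ↦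
    cycleLinked_of_subgraph (h.critical i).1
      (fun t ht ↦ (h.vertex_fixed i).2 _ (by simp) t ht)
      (fun t ht ↦ (h.vertex_succ_fixed i).2 _ (by simp) t ht)
  have from_zero : ∀ k : Fin (n + 1),
      Relation.ReflTransGen (fun p q ↦ CycleLinked G p q ∧ c p = c q) (v 0) (v k) := fun k ↦ by
    induction k using Fin.induction with
    | zero => exact .refl
    | succ k ih => exact ih.tail ⟨step k, h.color_eq c k⟩
  have to_zero : ∀ k : Fin (n + 1),
      Relation.ReflTransGen (fun p q ↦ CycleLinked G p q ∧ c p = c q) (v k) (v 0) := fun k ↦ by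
    induction k using Fin.induction with
    | zero => exact .refl
    | succ k ih => exact ih.head ⟨(step k).symm, (h.color_eq c k).symm⟩
  exact (to_zero i).trans (from_zero j)

end ColorFixation

theorem lemma5 {V : Type*} (G : SimpleGraph V) (hG : G.chromaticNumber = 4)
    (P : ColorFixation.PlaneEmbedding G) {n : ℕ} (v : Fin (n + 1) → V) (C : Fin n → G.Subgraph)
    (hC : ColorFixation.IsColorFixationChain G 4 v C) (i j : Fin (n + 1)) (hij : v i ≠ v j) :
    ¬ P.Adjaceable (v i) (v j) := by
  obtain ⟨c⟩ : G.Colorable 4 := chromaticNumber_le_iff_colorable.1 hG.le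
  exact fun h ↦ h.2 (P.exists_oppositeSides c (fun _ _ ↦ c.valid) hij (hC.reflTransGen c i j))
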